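/- Let $k \le n$ be positive integers. Let $I_{n,k} \subseteq \mathbb{Q}[x_1,\dots,x_n]$ be the ideal generated by $x_1^k, \dots, x_n^k$ and the elementary symmetric polynomials $e_n, e_{n-1}, \dots, e_{n-k+1}$ in $x_1,\dots,x_n$, and let $R_{n,k} = \mathbb{Q}[x_1,\dots,x_n]/I_{n,k}$. An $(n,k)$-staircase is a shuffle (an interleaving preserving both relative orders) of the sequence $(0,1,\dots,k-1)$ and the sequence $(k-1,\dots,k-1)$ of length $n-k$. Let $\mathcal{A}_{n,k}$ be the set of monomials $x_1^{a_1}\cdots x_n^{a_n}$ such that $(a_1,\dots,a_n)$ is componentwise $\le$ some $(n,k)$-staircase. For $S = \{s_1 < \cdots < s_m\} \subseteq \{1,\dots,n\}$ let $\mathbf{x}(S) = x_{s_1}^{s_1} x_{s_2}^{s_2-1} \cdots x_{s_m}^{s_m-m+1}$. Let $\mathcal{M}_{n,k}$ be the set of $(n,k)$-nonskip monomials, that is, monomials $m$ in $x_1,\dots,x_n$ such that $\mathbf{x}(S) \nmid m$ for all $S \subseteq \{1,\dots,n\}$ with $|S| = n-k+1$, and $x_i^k \nmid m$ for all $1 \le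 i \le n$. **Theorem.** We have $\mathcal{A}_{n,k} = \mathcal{M}_{n,k}$. Moreover, $\mathcal{A}_{n,k}$ is the set of standard monomials of $I_{n,k}$ for the lexicographic order with $x_1 > x_2 > \cdots > x_n$, that is, the set of monomials not divisible by the leading monomial of any nonzero element of $I_{n,k}$; and the cosets $m + I_{n,k}$, for $m \in \mathcal{A}_{n,k}$ (pairwise distinct), form a $\mathbb{Q}$-vector space basis of $R_{n,k}$. -/

import Mathlib

open MvPolynomial

noncomputable section

namespace DeltaArtin

/-- The ideal `I_{n,k} = ⟨x_1^k, …, x_n^k, e_n, e_{n-1}, …, e_{n-k+1}⟩` of `ℚ[x_1, …, x_n]`. The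
variable `x_i` of the mathematical text is `X (i - 1)`, since `Fin n = {0, …, n - 1}`. -/
def idealI (n k : ℕ) : Ideal (MvPolynomial (Fin n) ℚ) :=
  Ideal.span (Set.range (fun i : Fin n => (X i : MvPolynomial (Fin n) ℚ) ^ k) ∪
    (fun r : ℕ => esymm (Fin n) ℚ r) '' Set.Icc (n - k + 1) n)

/-- The quotient ring `R_{n,k} = ℚ[x_1, …, x_n] / I_{n,k}`. -/
abbrev RingR (n k : ℕ) : Type := MvPolynomial (Fin n) ℚ ⧸ idealI n k

/-- The sequence `c` is a shuffle of the sequences `a` and `b`: the positions of `c` are split into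
those occupied by `a` and those occupied by `b`, in both cases in the original relative order. -/
def IsShuffle {α : Type*} {r s N : ℕ} (a : Fin r → α) (b : Fin s → α) (c : Fin N → α) : Prop :=
  ∃ (f : Fin r ↪o Fin N) (g : Fin s ↪o Fin N),
    IsCompl (Set.range f) (Set.range g) ∧ (∀ i, c (f i) = a i) ∧ (∀ j, c (g j) = b j)

/-- An `(n,k)`-staircase: a shuffle of `(0, 1, …, k-1)` and of `n - k` copies of `k - 1`. -/
def IsStaircase (n k : ℕ) (c : Fin n → ℕ) : Prop :=
  IsShuffle (fun i : Fin k => (i : ℕ)) (fun _ : Fin (n - k) => k - 1) c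

/-- The set `A_{n,k}` of `(n,k)`-Artin monomials: the monomials whose exponent vector is
componentwise at most some `(n,k)`-staircase. -/
def artinMonomials (n k : ℕ) : Set (MvPolynomial (Fin n) ℚ) :=
  {p | ∃ a : Fin n →₀ ℕ, p = monomial a 1 ∧
    ∃ c : Fin n → ℕ, IsStaircase n k c ∧ ∀ i, a i ≤ c i}

/-- The skip monomial `x(S) = x_{s_1}^{s_1} x_{s_2}^{s_2 - 1} ⋯ x_{s_m}^{s_m - m + 1}` of
`S = {s_1 < ⋯ < s_m} ⊆ {1, …, n}`. The element `s_j` is represented by `i : Fin n` with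
`i + 1 = s_j`, and `j - 1` is the number of elements of `S` below it (at most `i`). -/
def skipMonomial {n : ℕ} (S : Finset (Fin n)) : MvPolynomial (Fin n) ℚ :=
  ∏ i ∈ S, X i ^ ((i : ℕ) + 1 - (S.filter (fun t => t < i)).card)

/-- The set `M_{n,k}` of `(n,k)`-nonskip monomials. -/
def nonskipMonomials (n k : ℕ) : Set (MvPolynomial (Fin n) ℚ) :=
  {p | (∃ a : Fin n →₀ ℕ, p = monomial a 1) ∧
    (∀ S : Finset (Fin n), S.card = n - k + 1 → ¬ skipMonomial S ∣ p) ∧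
    (∀ i : Fin n, ¬ (X i : MvPolynomial (Fin n) ℚ) ^ k ∣ p)}

/-- The leading monomial of a (nonzero) polynomial with respect to a monomial order. -/
def leadingMonomial {σ : Type*} (ord : MonomialOrder σ) (f : MvPolynomial σ ℚ) :
    MvPolynomial σ ℚ :=
  monomial (ord.degree f) 1

/-- The standard monomials of an ideal `I`: the monomials that are divisible by the leading
monomial of no nonzero element of `I`. -/
def standardMonomials {σ : Type*} (ord : MonomialOrder σ) (I : Ideal (MvPolynomial σ ℚ)) :
    Set (MvPolynomial σ ℚ) :=
  {p | (∃ a : σ →₀ ℕ, p = monomial a 1) ∧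
    ∀ f ∈ I, f ≠ 0 → ¬ leadingMonomial ord f ∣ p}

end DeltaArtin

end

/-! The set of standard exponents is squeezed between two counts, both equal to the number of
surjections from `Fin n` to `Fin k`.

Artin and nonskip vectors coincide by a greedy scan: accept position `i` when `a i` is at most the
number of positions accepted so far. If at least `k` positions are accepted, the first `k` carry the
increasing part of a staircase; otherwise the first `n - k + 1` rejected ones form a skip set
(`isArtin_or_exists_skip`). The words over `Fin k` accepting at least `k` positions satisfy the same
recurrence as the words with `k` distinct letters, so there are at most as many Artin vectors as
surjections (`card_isArtin_le`).

Every skip monomial is the lex leading monomial of an element of the ideal, namely a determinant of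
complete homogeneous symmetric polynomials (`det_hsymmMatrix_mem`, `degree_det_hsymmMatrix`). Hence
standard monomials are nonskip.

Conversely, regard the surjective words as points of `ℚ^n`. Each generator agrees on them with a
polynomial of lower degree, so the standard monomials, which span modulo the ideal, already
interpolate every function on these points (`card_points_le`). There are thus at least as many
standard monomials as surjections, and the inclusion is an equality. The basis statement then holds
as for any ideal and monomial order. -/

noncomputable section

namespace DeltaArtin

/-! ### Staircases, the greedy scan and skip sets -/

/-- The number of elements of `S` that are smaller than `i`. -/
def countBelow {n : ℕ} (S : Finset (Fin n)) (i : Fin n) : ℕ := (S.filter (fun t => t < i)).card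

/-- The vectors that are bounded by some `(n,k)`-staircase, described by the set of positions of the
increasing part of the staircase. -/
def IsArtin (n k : ℕ) (a : Fin n → ℕ) : Prop :=
  (∀ i, a i < k) ∧ ∃ T : Finset (Fin n), T.card = k ∧ ∀ i ∈ T, a i ≤ countBelow T i

theorem countBelow_map {m n : ℕ} (f : Fin m ↪o Fin n) (i : Fin m) :
    countBelow (Finset.univ.map f.toEmbedding) (f i) = i := by
  have : (Finset.univ.map f.toEmbedding).filter (fun t => t < f i) =
      (Finset.Iio i).map f.toEmbedding := by
    ext t
    simp only [Finset.mem_filter, Finset.mem_map, Finset.mem_univ, true_and, Finset.mem_Iio,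
      RelEmbedding.coe_toEmbedding]
    constructor
    · rintro ⟨⟨u, rfl⟩, h⟩
      exact ⟨u, f.lt_iff_lt.1 h, rfl⟩
    · rintro ⟨u, h, rfl⟩
      exact ⟨⟨u, rfl⟩, f.lt_iff_lt.2 h⟩
  rw [countBelow, this, Finset.card_map, Fin.card_Iio]

theorem map_orderEmbOfFin_univ {m n : ℕ} (T : Finset (Fin n)) (h : T.card = m) :
    Finset.univ.map (T.orderEmbOfFin h).toEmbedding = T := by
  ext t
  have := Finset.range_orderEmbOfFin T h
  rw [← Finset.mem_coe (s := T), ← this]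
  simp

theorem countBelow_orderEmbOfFin {m n : ℕ} (T : Finset (Fin n)) (h : T.card = m) (i : Fin m) :
    countBelow T (T.orderEmbOfFin h i) = i := by
  have := countBelow_map (T.orderEmbOfFin h) i
  rwa [map_orderEmbOfFin_univ T h] at this

/-- At a position of the increasing part, the staircase value is the number of earlier such
positions; elsewhere it is `k - 1`, which only says `a i < k`. -/
theorem exists_staircase_iff_isArtin {n k : ℕ} (hk : 0 < k) (a : Fin n → ℕ) :
    (∃ c : Fin n → ℕ, IsStaircase n k c ∧ ∀ i, a i ≤ c i) ↔ IsArtin n k a := by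
  constructor
  · rintro ⟨c, ⟨f, g, hfg, hf, hg⟩, hac⟩
    refine ⟨fun i => ?_, Finset.univ.map f.toEmbedding, by simp, ?_⟩
    · have hi : i ∈ Set.range f ⊔ Set.range g := by rw [hfg.sup_eq_top]; trivial
      rcases hi with ⟨j, rfl⟩ | ⟨j, rfl⟩
      · exact (hf j ▸ hac (f j)).trans_lt j.2
      · exact (hg j ▸ hac (g j)).trans_lt (Nat.sub_lt hk one_pos)
    · intro i hi
      obtain ⟨j, -, rfl⟩ := Finset.mem_map.1 hi
      have := hac (f j)
      rw [hf] at this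
      simpa only [RelEmbedding.coe_toEmbedding, countBelow_map] using this
  · rintro ⟨hlt, T, hT, h⟩
    have hTc : Tᶜ.card = n - k := by rw [Finset.card_compl, hT, Fintype.card_fin]
    refine ⟨fun i => if i ∈ T then countBelow T i else k - 1,
      ⟨T.orderEmbOfFin hT, Tᶜ.orderEmbOfFin hTc, ?_, ?_, ?_⟩, ?_⟩
    · rw [Finset.range_orderEmbOfFin, Finset.range_orderEmbOfFin, Finset.coe_compl]
      exact isCompl_compl
    · intro i
      simp [Finset.orderEmbOfFin_mem, countBelow_orderEmbOfFin]
    · intro j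
      have := Finset.mem_compl.1 (Finset.orderEmbOfFin_mem Tᶜ hTc j)
      simp [this]
    · intro i
      dsimp only
      split_ifs with hi
      · exact h i hi
      · have := hlt i; omega

/-- Truncating to an initial segment leaves `countBelow` unchanged at the elements kept, so
inequalities for a large set pass to one of prescribed size. -/
theorem exists_initial_subset {n : ℕ} (S : Finset (Fin n)) (l : ℕ) (hl : l ≤ S.card) :
    ∃ S' ⊆ S, S'.card = l ∧ ∀ i ∈ S', ∀ t ∈ S, t < i → t ∈ S' := by
  induction S using Finset.induction_on_max with
  | empty => exact ⟨∅, by simp, (Nat.le_zero.1 hl).symm, by simp⟩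
  | insert a s ha ih =>
    have has : a ∉ s := fun h => lt_irrefl _ (ha a h)
    rw [Finset.card_insert_of_notMem has] at hl
    rcases Nat.lt_or_ge s.card l with h | h
    · exact ⟨insert a s, subset_rfl, by rw [Finset.card_insert_of_notMem has]; omega,
        fun _ _ t ht _ => ht⟩
    · obtain ⟨S', hS', hc, hS⟩ := ih h
      refine ⟨S', hS'.trans (Finset.subset_insert _ _), hc, fun i hi t ht hti => ?_⟩
      rcases Finset.mem_insert.1 ht with rfl | ht
      · exact absurd hti (ha i (hS' hi)).asymm
      · exact hS i hi t ht hti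

theorem countBelow_congr {n : ℕ} {S S' : Finset (Fin n)} (h : S' ⊆ S) {i : Fin n}
    (hi : ∀ t ∈ S, t < i → t ∈ S') : countBelow S' i = countBelow S i := by
  unfold countBelow
  congr 1
  ext t
  simp only [Finset.mem_filter]
  exact ⟨fun ⟨h1, h2⟩ => ⟨h h1, h2⟩, fun ⟨h1, h2⟩ => ⟨hi t h1 h2, h2⟩⟩

theorem countBelow_add_countBelow_compl {n : ℕ} (S : Finset (Fin n)) (i : Fin n) :
    countBelow S i + countBelow Sᶜ i = i := by
  have h1 : S.filter (fun t => t < i) = (Finset.Iio i).filter (fun t => t ∈ S) := by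
    ext; simp [and_comm]
  have h2 : Sᶜ.filter (fun t => t < i) = (Finset.Iio i).filter (fun t => ¬ t ∈ S) := by
    ext; simp [and_comm]
  rw [countBelow, countBelow, h1, h2, Finset.card_filter_add_card_filter_not, Fin.card_Iio]

/-- The greedy run of the automaton that looks for positions with `a i ≤` the current state,
starting in state `j`: the final state. -/
def greedy : (n : ℕ) → (Fin n → ℕ) → ℕ → ℕ
  | 0, _, j => j
  | n + 1, a, j => if a 0 ≤ j then greedy n (Fin.tail a) (j + 1) else greedy n (Fin.tail a) j

theorem countBelow_map_succ {n : ℕ} (T : Finset (Fin n)) (i : Fin n) :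
    countBelow (T.map (Fin.succEmb n)) i.succ = countBelow T i := by
  unfold countBelow
  rw [Finset.filter_map, Finset.card_map]
  congr 1
  ext t
  rw [Finset.mem_filter, Finset.mem_filter]
  exact and_congr_right fun _ => Fin.succ_lt_succ_iff

theorem countBelow_insert_zero {n : ℕ} (T : Finset (Fin n)) (i : Fin n) :
    countBelow (insert 0 (T.map (Fin.succEmb n))) i.succ = countBelow T i + 1 := by
  rw [← countBelow_map_succ T i]
  unfold countBelow
  rw [Finset.filter_insert, if_pos (Fin.succ_pos i), Finset.card_insert_of_notMem]
  simp

theorem countBelow_zero {n : ℕ} (T : Finset (Fin (n + 1))) : countBelow T 0 = 0 := by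
  simp [countBelow]

/-- `T` is the set of accepted positions: the state on reaching `i` is `j + countBelow T i`. -/
theorem exists_greedy_set (n : ℕ) (a : Fin n → ℕ) (j : ℕ) :
    ∃ T : Finset (Fin n), T.card + j = greedy n a j ∧
      ∀ i, i ∈ T ↔ a i ≤ j + countBelow T i := by
  induction n generalizing j with
  | zero => exact ⟨∅, by simp [greedy], fun i => i.elim0⟩
  | succ n ih =>
    by_cases h : a 0 ≤ j
    · obtain ⟨T, hT, hi⟩ := ih (Fin.tail a) (j + 1)
      refine ⟨insert 0 (T.map (Fin.succEmb n)), ?_, fun i => ?_⟩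
      · rw [greedy, if_pos h, ← hT, Finset.card_insert_of_notMem (by simp), Finset.card_map]
        omega
      · refine Fin.cases ?_ (fun i => ?_) i
        · simp [countBelow_zero, h]
        · rw [countBelow_insert_zero]
          have := hi i
          simp only [Fin.tail] at this
          simp [Fin.succ_ne_zero, this, add_comm, add_left_comm]
    · obtain ⟨T, hT, hi⟩ := ih (Fin.tail a) j
      refine ⟨T.map (Fin.succEmb n), ?_, fun i => ?_⟩
      · rw [greedy, if_neg h, ← hT, Finset.card_map]
      · refine Fin.cases ?_ (fun i => ?_) i
        · simp [countBelow_zero, h]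
        · rw [countBelow_map_succ]
          have := hi i
          simp only [Fin.tail] at this
          simp [this]

/-- The exponent vectors of nonskip monomials. -/
def IsNonskip (n k : ℕ) (a : Fin n → ℕ) : Prop :=
  (∀ i, a i < k) ∧ ∀ S : Finset (Fin n), S.card = n - k + 1 →
    ∃ i ∈ S, a i < (i : ℕ) + 1 - countBelow S i

/-- The sizes of `T` and `S` add up to `n + 1`, so they meet. Below their least common element `i`,
the set `T` avoids `S`, whence `a i ≤ countBelow T i ≤ i - countBelow S i`. -/
theorem isNonskip_of_isArtin {n k : ℕ} {a : Fin n → ℕ} (h : IsArtin n k a) : IsNonskip n k a := by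
  obtain ⟨hlt, T, hT, hTa⟩ := h
  refine ⟨hlt, fun S hS => ?_⟩
  have hne : (T ∩ S).Nonempty := by
    have h1 := Finset.card_union_add_card_inter T S
    have h2 : (T ∪ S).card ≤ n := by simpa using Finset.card_le_univ (T ∪ S)
    have h3 : k ≤ n := by rw [← hT]; simpa using Finset.card_le_univ T
    rw [← Finset.card_pos]
    omega
  have hmem := Finset.min'_mem _ hne
  set i := (T ∩ S).min' hne
  refine ⟨i, (Finset.mem_inter.1 hmem).2, ?_⟩
  have h1 := hTa i (Finset.mem_inter.1 hmem).1
  have h2 := countBelow_add_countBelow_compl S i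
  have h3 : countBelow T i ≤ countBelow Sᶜ i := by
    refine Finset.card_le_card fun t ht => ?_
    simp only [Finset.mem_filter, Finset.mem_compl] at ht ⊢
    exact ⟨fun hS => absurd (Finset.min'_le _ t (Finset.mem_inter.2 ⟨ht.1, hS⟩)) ht.2.not_ge, ht.2⟩
  omega

/-- At a rejected position, `a i` exceeds the number of accepted positions before it, which is `i`
minus the number of rejected ones: exactly the skip inequality. -/
theorem isArtin_or_exists_skip {n k : ℕ} (hkn : k ≤ n) {a : Fin n → ℕ} (hlt : ∀ i, a i < k) :
    (k ≤ greedy n a 0 ∧ IsArtin n k a) ∨ ∃ S : Finset (Fin n), S.card = n - k + 1 ∧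
      ∀ i ∈ S, (i : ℕ) + 1 - countBelow S i ≤ a i := by
  obtain ⟨G, hG, hGa⟩ := exists_greedy_set n a 0
  simp only [add_zero, zero_add] at hG hGa
  rcases Nat.lt_or_ge G.card k with h | h
  · right
    have hc : n - k + 1 ≤ Gᶜ.card := by rw [Finset.card_compl, Fintype.card_fin]; omega
    obtain ⟨S, hS, hSc, hi⟩ := exists_initial_subset Gᶜ _ hc
    refine ⟨S, hSc, fun i hiS => ?_⟩
    rw [countBelow_congr hS (hi i hiS)]
    have h1 := countBelow_add_countBelow_compl G i
    have h2 := mt (hGa i).2 (Finset.mem_compl.1 (hS hiS))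
    omega
  · left
    obtain ⟨T, hT, hTc, hi⟩ := exists_initial_subset G _ h
    refine ⟨hG ▸ h, hlt, T, hTc, fun i hiT => ?_⟩
    rw [countBelow_congr hT (hi i hiT)]
    exact (hGa i).1 (hT hiT)

theorem isArtin_iff_isNonskip {n k : ℕ} (hkn : k ≤ n) (a : Fin n → ℕ) :
    IsArtin n k a ↔ IsNonskip n k a := by
  refine ⟨isNonskip_of_isArtin, fun h => ?_⟩
  rcases isArtin_or_exists_skip hkn h.1 with h' | ⟨S, hS, hSa⟩
  · exact h'.2
  · obtain ⟨i, hi, hlt⟩ := h.2 S hS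
    exact absurd (hSa i hi) hlt.not_ge

theorem le_greedy_of_isArtin {n k : ℕ} (hkn : k ≤ n) {a : Fin n → ℕ} (h : IsArtin n k a) :
    k ≤ greedy n a 0 := by
  rcases isArtin_or_exists_skip hkn h.1 with h' | ⟨S, hS, hSa⟩
  · exact h'.1
  · obtain ⟨i, hi, hlt⟩ := (isNonskip_of_isArtin h).2 S hS
    exact absurd (hSa i hi) hlt.not_ge

/-! ### From exponent vectors to monomials -/

theorem skipMonomial_eq_monomial {n : ℕ} (S : Finset (Fin n)) :
    skipMonomial S =
      monomial (∑ i ∈ S, Finsupp.single i ((i : ℕ) + 1 - countBelow S i)) 1 := by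
  rw [skipMonomial, monomial_sum_one]
  simp only [X_pow_eq_monomial, countBelow]

theorem sum_single_apply {n : ℕ} (S : Finset (Fin n)) (e : Fin n → ℕ) (i : Fin n) :
    (∑ j ∈ S, Finsupp.single j (e j)) i = if i ∈ S then e i else 0 := by
  simp [Finsupp.finsetSum_apply, Finsupp.single_apply]

theorem skipMonomial_dvd_iff {n : ℕ} (S : Finset (Fin n)) (a : Fin n →₀ ℕ) :
    skipMonomial S ∣ monomial a 1 ↔ ∀ i ∈ S, (i : ℕ) + 1 - countBelow S i ≤ a i := by
  rw [skipMonomial_eq_monomial, monomial_one_dvd_monomial_one, Finsupp.le_def]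
  refine forall_congr' fun i => ?_
  rw [sum_single_apply]
  split_ifs with h <;> simp [h]

theorem monomial_mem_nonskipMonomials_iff {n k : ℕ} (a : Fin n →₀ ℕ) :
    monomial a 1 ∈ nonskipMonomials n k ↔ IsNonskip n k a := by
  simp only [nonskipMonomials, Set.mem_ofPred_eq, skipMonomial_dvd_iff, IsNonskip,
    X_pow_eq_monomial, monomial_one_dvd_monomial_one, Finsupp.single_le_iff, not_le]
  constructor
  · rintro ⟨-, h1, h2⟩
    exact ⟨h2, fun S hS => by simpa only [not_forall, not_le, exists_prop] using h1 S hS⟩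
  · rintro ⟨h1, h2⟩
    exact ⟨⟨a, rfl⟩, fun S hS => by simpa only [not_forall, not_le, exists_prop] using h2 S hS, h1⟩

theorem artinMonomials_eq_image {n k : ℕ} (hk : 0 < k) :
    artinMonomials n k = (fun a : Fin n →₀ ℕ => monomial a 1) '' {a | IsArtin n k a} := by
  ext p
  simp only [artinMonomials, Set.mem_ofPred_eq, exists_staircase_iff_isArtin hk, Set.mem_image]
  exact exists_congr fun a => by rw [and_comm, eq_comm]

theorem artinMonomials_eq_nonskipMonomials {n k : ℕ} (hk : 0 < k) (hkn : k ≤ n) :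
    artinMonomials n k = nonskipMonomials n k := by
  rw [artinMonomials_eq_image hk]
  ext p
  constructor
  · rintro ⟨a, ha, rfl⟩
    exact (monomial_mem_nonskipMonomials_iff a).2 ((isArtin_iff_isNonskip hkn a).1 ha)
  · intro hp
    obtain ⟨a, rfl⟩ := hp.1
    exact ⟨a, (isArtin_iff_isNonskip hkn a).2 ((monomial_mem_nonskipMonomials_iff a).1 hp), rfl⟩

/-! ### Counting Artin vectors by surjections -/

/-- The number of words of length `n` over `Fin k` whose greedy run from state `j` reaches `k`. -/
def greedyCount (k n j : ℕ) : ℕ :=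
  (Finset.univ.filter fun a : Fin n → Fin k => k ≤ greedy n (fun i => a i) j).card

/-- The number of words of length `n` over `Fin k` with at least `m` distinct letters. -/
def imageCount (k n m : ℕ) : ℕ :=
  (Finset.univ.filter fun w : Fin n → Fin k => m ≤ (Finset.univ.image w).card).card

theorem le_greedy (n : ℕ) (a : Fin n → ℕ) (j : ℕ) : j ≤ greedy n a j := by
  obtain ⟨T, hT, -⟩ := exists_greedy_set n a j
  omega

theorem greedyCount_self (k n : ℕ) : greedyCount k n k = imageCount k n 0 := by
  simp [greedyCount, imageCount, le_greedy]

theorem card_filter_cons {k n : ℕ} (P : (Fin (n + 1) → Fin k) → Prop) [DecidablePred P] :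
    (Finset.univ.filter P).card =
      ∑ x : Fin k, ∑ a : Fin n → Fin k, if P (Fin.cons x a) then 1 else 0 := by
  rw [Finset.card_filter, ← Fintype.sum_prod_type']
  exact (Fintype.sum_equiv (Fin.consEquiv fun _ => Fin k) _ _ fun _ => rfl).symm

theorem card_filter_val_le {k j : ℕ} (hj : j < k) :
    (Finset.univ.filter fun x : Fin k => (x : ℕ) ≤ j).card = j + 1 := by
  have : (Finset.univ.filter fun x : Fin k => (x : ℕ) ≤ j) = Finset.Iic ⟨j, hj⟩ := by
    ext x; simp [Fin.le_def]
  rw [this, Fin.card_Iic]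

/-- Of the `k` possible first letters, the `j + 1` letters at most `j` advance the state and the
others leave it fixed. -/
theorem greedyCount_succ {k n j : ℕ} (hj : j < k) :
    greedyCount k (n + 1) j =
      (j + 1) * greedyCount k n (j + 1) + (k - (j + 1)) * greedyCount k n j := by
  have key : ∀ x : Fin k, (∑ a : Fin n → Fin k,
      if k ≤ greedy (n + 1) (fun i => ((Fin.cons x a : Fin (n + 1) → Fin k) i : ℕ)) j
        then 1 else 0) =
      if (x : ℕ) ≤ j then greedyCount k n (j + 1) else greedyCount k n j := by
    intro x
    simp only [greedy, Fin.cons_zero, Fin.tail_def, Fin.cons_succ]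
    split_ifs with h <;> rw [greedyCount, Finset.card_filter]
  rw [greedyCount, card_filter_cons, Finset.sum_congr rfl fun x _ => key x, Finset.sum_ite,
    Finset.sum_const, Finset.sum_const, smul_eq_mul, smul_eq_mul, card_filter_val_le hj,
    Finset.filter_not, Finset.card_sdiff_of_subset (Finset.filter_subset _ _),
    card_filter_val_le hj, Finset.card_univ, Fintype.card_fin]

/-- Only `s.card = k - j - 1` is delicate: then precisely the `j + 1` letters outside `s` reach the
threshold. For larger `s` all `k` letters do, for smaller `s` none. -/
theorem sum_le_card_insert {k j : ℕ} (hj : j < k) (s : Finset (Fin k)) :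
    (∑ x : Fin k, if k - j ≤ (insert x s).card then 1 else 0) =
      (j + 1) * (if k - (j + 1) ≤ s.card then 1 else 0) +
        (k - (j + 1)) * (if k - j ≤ s.card then 1 else 0) := by
  have hsplit : (∑ x : Fin k, if k - j ≤ (insert x s).card then 1 else 0) =
      s.card * (if k - j ≤ s.card then 1 else 0) +
        (k - s.card) * (if k - j ≤ s.card + 1 then 1 else 0) := by
    rw [← Finset.sum_add_sum_compl s]
    congr 1
    · rw [← smul_eq_mul, ← Finset.sum_const]
      exact Finset.sum_congr rfl fun x hx => by rw [Finset.insert_eq_of_mem hx]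
    · have : k - s.card = sᶜ.card := by rw [Finset.card_compl, Fintype.card_fin]
      rw [this, ← smul_eq_mul, ← Finset.sum_const]
      exact Finset.sum_congr rfl fun x hx => by
        rw [Finset.card_insert_of_notMem (Finset.mem_compl.1 hx)]
  have hs : s.card ≤ k := by simpa using Finset.card_le_univ s
  rw [hsplit]
  split_ifs <;> omega

theorem imageCount_succ {k n j : ℕ} (hj : j < k) :
    imageCount k (n + 1) (k - j) =
      (j + 1) * imageCount k n (k - (j + 1)) + (k - (j + 1)) * imageCount k n (k - j) := by
  have himage : ∀ (x : Fin k) (w : Fin n → Fin k),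
      Finset.univ.image (Fin.cons x w : Fin (n + 1) → Fin k) =
        insert x (Finset.univ.image w) := by
    intro x w
    ext y
    simp [Fin.exists_fin_succ, eq_comm]
  rw [imageCount, card_filter_cons, Finset.sum_comm]
  simp only [himage, sum_le_card_insert hj]
  rw [Finset.sum_add_distrib, ← Finset.mul_sum, ← Finset.mul_sum, imageCount, imageCount,
    Finset.card_filter, Finset.card_filter]

theorem greedyCount_eq_imageCount (k n j : ℕ) (hj : j ≤ k) :
    greedyCount k n j = imageCount k n (k - j) := by
  induction n generalizing j with
  | zero =>
    rcases hj.eq_or_lt with rfl | h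
    · rw [greedyCount_self, Nat.sub_self]
    · have h' : k - j ≠ 0 := by omega
      simp [greedyCount, imageCount, greedy, h.not_ge, h']
  | succ n ih =>
    rcases hj.eq_or_lt with rfl | h
    · rw [greedyCount_self, Nat.sub_self]
    · rw [greedyCount_succ h, imageCount_succ h, ih _ h, ih _ h.le]

theorem imageCount_eq_card_surjective (n k : ℕ) :
    imageCount k n k = Nat.card {w : Fin n → Fin k // Function.Surjective w} := by
  rw [imageCount, Nat.card_eq_fintype_card, Fintype.card_subtype]
  congr 1
  ext w
  have hw : Function.Surjective w ↔ (Finset.univ.image w).card = k := by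
    conv_rhs => rhs; rw [← Fintype.card_fin k]
    rw [Finset.card_eq_iff_eq_univ, Finset.eq_univ_iff_forall]
    simp [Function.Surjective]
  rw [Finset.mem_filter, Finset.mem_filter, hw]
  have : (Finset.univ.image w).card ≤ k := by simpa using Finset.card_le_univ (Finset.univ.image w)
  simp only [Finset.mem_univ, true_and]
  omega

theorem card_isArtin_le {n k : ℕ} (hkn : k ≤ n) :
    Finite {a : Fin n →₀ ℕ | IsArtin n k a} ∧
      Nat.card {a : Fin n →₀ ℕ | IsArtin n k a} ≤
        Nat.card {w : Fin n → Fin k // Function.Surjective w} := by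
  let φ : {a : Fin n →₀ ℕ | IsArtin n k a} →
      {a : Fin n → Fin k // k ≤ greedy n (fun i => a i) 0} := fun a =>
    ⟨fun i => ⟨a.1 i, a.2.1 i⟩, le_greedy_of_isArtin hkn a.2⟩
  have hφ : Function.Injective φ := by
    intro a b hab
    refine Subtype.ext (Finsupp.ext fun i => ?_)
    have := congrFun (congrArg Subtype.val hab) i
    exact congrArg Fin.val this
  refine ⟨Finite.of_injective φ hφ, ?_⟩
  rw [← imageCount_eq_card_surjective,
    show imageCount k n k = greedyCount k n 0 from (greedyCount_eq_imageCount k n 0 k.zero_le).symm]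
  refine (Nat.card_le_card_of_injective φ hφ).trans ?_
  rw [greedyCount, Nat.card_eq_fintype_card, Fintype.card_subtype]

/-! ### Skip monomials as leading monomials of determinants -/

open scoped MonomialOrder

/-- The generating function `∏ (1 - x_i T)` of the signed elementary symmetric polynomials. -/
def esymmSeries (n : ℕ) : PowerSeries (MvPolynomial (Fin n) ℚ) :=
  ∏ i, (1 - PowerSeries.C (X i) * PowerSeries.X)

/-- The generating function `∏ 1 / (1 - x_i T)`, over `i ∈ s`, of the complete homogeneous symmetric
polynomials in the variables `x_i`, `i ∈ s`. -/
def hsymmSeries {n : ℕ} (s : Finset (Fin n)) : PowerSeries (MvPolynomial (Fin n) ℚ) :=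
  ∏ i ∈ s, PowerSeries.mk fun j => X i ^ j

theorem coeff_prod_one_sub {R ι : Type*} [CommRing R] (s : Finset ι) (x : ι → R) (r : ℕ) :
    PowerSeries.coeff r (∏ i ∈ s, (1 - PowerSeries.C (x i) * PowerSeries.X)) =
      (-1) ^ r * ∑ t ∈ s.powersetCard r, ∏ i ∈ t, x i := by
  classical
  simp only [sub_eq_add_neg, Finset.prod_one_add, Finset.prod_neg, Finset.prod_mul_distrib,
    Finset.prod_const, ← map_prod]
  rw [map_sum, Finset.mul_sum, Finset.powersetCard_eq_filter, Finset.sum_filter]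
  refine Finset.sum_congr rfl fun t _ => ?_
  have : ((-1) ^ t.card * (PowerSeries.C (∏ i ∈ t, x i) * PowerSeries.X ^ t.card) :
      PowerSeries R) =
      PowerSeries.C ((-1) ^ t.card * ∏ i ∈ t, x i) * PowerSeries.X ^ t.card := by
    simp [mul_assoc]
  rw [this, PowerSeries.coeff_C_mul, PowerSeries.coeff_X_pow]
  by_cases h : r = t.card
  · simp [h]
  · simp [h, Ne.symm h]

theorem coeff_esymmSeries (n r : ℕ) :
    PowerSeries.coeff r (esymmSeries n) = (-1) ^ r * esymm (Fin n) ℚ r :=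
  coeff_prod_one_sub _ _ _

theorem mk_pow_mul_one_sub {R : Type*} [CommRing R] (x : R) :
    (PowerSeries.mk fun j => x ^ j) * (1 - PowerSeries.C x * PowerSeries.X) = 1 := by
  ext r
  rw [mul_sub, mul_one, ← mul_assoc, map_sub]
  cases r with
  | zero => simp
  | succ r => simp [PowerSeries.coeff_succ_mul_X, PowerSeries.coeff_one, pow_succ]

/-- The factors with index at least `p` cancel, leaving a polynomial in `T` of degree at most `p`.
-/
theorem coeff_esymmSeries_mul_hsymmSeries {n : ℕ} (p : Fin n) {r : ℕ} (hr : (p : ℕ) < r) :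
    PowerSeries.coeff r (esymmSeries n * hsymmSeries (Finset.Ici p)) = 0 := by
  have : esymmSeries n * hsymmSeries (Finset.Ici p) =
      ∏ i ∈ Finset.Iio p, (1 - PowerSeries.C (X i) * PowerSeries.X) := by
    have hc : (Finset.Ici p)ᶜ = Finset.Iio p := by ext; simp
    rw [esymmSeries, ← Finset.prod_mul_prod_compl (Finset.Ici p), hc, mul_right_comm, hsymmSeries,
      ← Finset.prod_mul_distrib, Finset.prod_eq_one, one_mul]
    intro i _
    rw [mul_comm, mk_pow_mul_one_sub]
  rw [this, coeff_prod_one_sub, Finset.powersetCard_eq_empty.2 (by simpa using hr)]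
  simp

theorem coeff_hsymmSeries {n : ℕ} (s : Finset (Fin n)) (r : ℕ) :
    PowerSeries.coeff r (hsymmSeries s) = ∑ l ∈ s.finsuppAntidiag r, monomial l 1 := by
  rw [hsymmSeries, PowerSeries.coeff_prod]
  refine Finset.sum_congr rfl fun l hl => ?_
  rw [Finset.mem_finsuppAntidiag] at hl
  simp only [PowerSeries.coeff_mk]
  rw [monomial_eq, C_1, one_mul, Finsupp.prod]
  exact (Finset.prod_subset hl.2 fun i _ hi => by simp [Finsupp.notMem_support_iff.1 hi]).symm

theorem toLex_le_single {n : ℕ} {p : Fin n} {r : ℕ} {l : Fin n →₀ ℕ}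
    (hl : l ∈ (Finset.Ici p).finsuppAntidiag r) : toLex l ≤ toLex (Finsupp.single p r) := by
  rw [Finset.mem_finsuppAntidiag] at hl
  have hp : p ∈ Finset.Ici p := by simp
  have hsum := Finset.add_sum_erase _ l hp
  rw [hl.1] at hsum
  rcases Nat.lt_or_ge (l p) r with h | h
  · refine le_of_lt (Finsupp.Lex.lt_iff.2 ⟨p, fun j hj => ?_, by simpa using h⟩)
    have h1 : l j = 0 := by
      by_contra hne
      have := hl.2 (Finsupp.mem_support_iff.2 hne)
      exact (Finset.mem_Ici.1 this).not_gt hj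
    simp [h1, hj.ne']
  · have h0 : ∑ i ∈ (Finset.Ici p).erase p, l i = 0 := by omega
    refine le_of_eq (congrArg toLex (Finsupp.ext fun i => ?_))
    rcases eq_or_ne i p with rfl | hne
    · rw [Finsupp.single_eq_same]; omega
    · rw [Finsupp.single_eq_of_ne hne]
      by_contra h1
      have h2 := hl.2 (Finsupp.mem_support_iff.2 h1)
      exact h1 (Finset.sum_eq_zero_iff.1 h0 i (Finset.mem_erase.2 ⟨hne, h2⟩))

theorem degree_coeff_hsymmSeries_le {n : ℕ} (p : Fin n) (r : ℕ) :
    MonomialOrder.lex.degree (PowerSeries.coeff r (hsymmSeries (Finset.Ici p)))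
      ≼[MonomialOrder.lex] Finsupp.single p r := by
  rw [coeff_hsymmSeries, MonomialOrder.degree_le_iff]
  intro c hc
  obtain ⟨l, hl, hcl⟩ := Finset.mem_biUnion.1 (support_sum hc)
  rw [Finset.mem_singleton.1 (support_monomial_subset hcl)]
  exact toLex_le_single hl

theorem degree_eq_of_coeff_eq_one {σ : Type*} {m : MonomialOrder σ} {f : MvPolynomial σ ℚ}
    {d : σ →₀ ℕ} (hle : m.degree f ≼[m] d) (hd : f.coeff d = 1) :
    m.degree f = d ∧ m.Monic f := by
  have h : m.degree f = d :=
    m.toSyn.injective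
      (le_antisymm hle (m.le_degree (mem_support_iff.2 (by rw [hd]; exact one_ne_zero))))
  exact ⟨h, by rw [MonomialOrder.Monic, MonomialOrder.leadingCoeff, h, hd]⟩

theorem degree_coeff_hsymmSeries {n : ℕ} (p : Fin n) (r : ℕ) :
    MonomialOrder.lex.degree (PowerSeries.coeff r (hsymmSeries (Finset.Ici p))) =
        Finsupp.single p r ∧
      MonomialOrder.lex.Monic (PowerSeries.coeff r (hsymmSeries (Finset.Ici p))) := by
  refine degree_eq_of_coeff_eq_one (degree_coeff_hsymmSeries_le p r) ?_
  rw [coeff_hsymmSeries, coeff_sum, Finset.sum_eq_single (Finsupp.single p r)]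
  · simp
  · intro l _ hl
    rw [coeff_monomial, if_neg hl]
  · intro h
    refine absurd (Finset.mem_finsuppAntidiag.2 ⟨?_, ?_⟩) h
    · simp [Finsupp.single_apply]
    · exact Finsupp.support_single_subset.trans (by simp)

/-- The matrix of complete homogeneous symmetric polynomials `h_{s j + 1 - i}` in the variables with
index at least `s j`. -/
def hsymmMatrix {m n : ℕ} (s : Fin m → Fin n) : Matrix (Fin m) (Fin m) (MvPolynomial (Fin n) ℚ) :=
  fun j i => PowerSeries.coeff ((s j : ℕ) + 1)
    (PowerSeries.X ^ (i : ℕ) * hsymmSeries (Finset.Ici (s j)))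

/-- The full relation `∑ ± h_{p+1-i} e_i = 0` loses only its terms with `i ≥ m`, which lie in `I`.
-/
theorem sum_esymm_mul_hsymm_mem {n m : ℕ} {I : Ideal (MvPolynomial (Fin n) ℚ)}
    (hI : ∀ r, m ≤ r → PowerSeries.coeff r (esymmSeries n) ∈ I) (p : Fin n) :
    ∑ i ∈ Finset.range m, PowerSeries.coeff ((p : ℕ) + 1)
      (PowerSeries.X ^ i * hsymmSeries (Finset.Ici p)) *
        PowerSeries.coeff i (esymmSeries n) ∈ I := by
  set f : ℕ → MvPolynomial (Fin n) ℚ := fun i => PowerSeries.coeff ((p : ℕ) + 1)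
      (PowerSeries.X ^ i * hsymmSeries (Finset.Ici p)) * PowerSeries.coeff i (esymmSeries n) with hf
  -- The range contains both `i < m` and all `i ≤ p + 1`; the surplus terms have `h` of negative
  -- index and vanish.
  have htot : ∑ i ∈ Finset.range (m + ((p : ℕ) + 2)), f i = 0 := by
    rw [← coeff_esymmSeries_mul_hsymmSeries p (Nat.lt_succ_self _), PowerSeries.coeff_mul,
      Finset.Nat.sum_antidiagonal_eq_sum_range_succ_mk]
    symm
    refine Finset.sum_subset_zero_on_sdiff (fun i hi => ?_) (fun i hi => ?_) (fun i hi => ?_)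
    · simp only [Finset.mem_range] at hi ⊢; omega
    · simp only [Finset.mem_sdiff, Finset.mem_range] at hi
      rw [hf]
      dsimp only
      rw [PowerSeries.coeff_X_pow_mul', if_neg (by omega), zero_mul]
    · simp only [Finset.mem_range] at hi
      rw [hf]
      dsimp only
      rw [PowerSeries.coeff_X_pow_mul', if_pos (by omega), mul_comm]
  rw [Finset.sum_range_add] at htot
  rw [eq_neg_of_add_eq_zero_left htot]
  exact I.neg_mem (I.sum_mem fun i _ => I.mul_mem_left _ (hI _ (Nat.le_add_right _ _)))

/-- Cramer's rule: the matrix maps the vector of signed `e_i`, `i < m`, into `I`, and multiplying by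
the adjugate gives `det` times this vector, whose zeroth entry is `e_0 = 1`. -/
theorem det_hsymmMatrix_mem {n m : ℕ} (hm : 0 < m) {I : Ideal (MvPolynomial (Fin n) ℚ)}
    (hI : ∀ r, m ≤ r → PowerSeries.coeff r (esymmSeries n) ∈ I) (s : Fin m → Fin n) :
    (hsymmMatrix s).det ∈ I := by
  set v : Fin m → MvPolynomial (Fin n) ℚ := fun i => PowerSeries.coeff (i : ℕ) (esymmSeries n)
  have hv : v ⟨0, hm⟩ = 1 := by simp [v, coeff_esymmSeries]
  have hMv : ∀ j, Matrix.mulVec (hsymmMatrix s) v j ∈ I := by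
    intro j
    rw [Matrix.mulVec, dotProduct]
    have := sum_esymm_mul_hsymm_mem hI (s j)
    rwa [← Fin.sum_univ_eq_sum_range (fun i => PowerSeries.coeff ((s j : ℕ) + 1)
      (PowerSeries.X ^ i * hsymmSeries (Finset.Ici (s j))) *
        PowerSeries.coeff i (esymmSeries n))] at this
  have hdet : (hsymmMatrix s).det =
      Matrix.mulVec (hsymmMatrix s).adjugate (Matrix.mulVec (hsymmMatrix s) v) ⟨0, hm⟩ := by
    rw [Matrix.mulVec_mulVec, Matrix.adjugate_mul, Matrix.smul_mulVec, Matrix.one_mulVec,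
      Pi.smul_apply, hv, smul_eq_mul, mul_one]
  rw [hdet, Matrix.mulVec, dotProduct]
  exact I.sum_mem fun j _ => I.mul_mem_left _ (hMv j)

theorem degree_hsymmMatrix_le {m n : ℕ} (s : Fin m → Fin n) (j i : Fin m) :
    MonomialOrder.lex.degree (hsymmMatrix s j i)
      ≼[MonomialOrder.lex] Finsupp.single (s j) ((s j : ℕ) + 1 - i) := by
  rw [hsymmMatrix, PowerSeries.coeff_X_pow_mul']
  split_ifs
  · exact degree_coeff_hsymmSeries_le _ _
  · rw [MonomialOrder.degree_zero, map_zero]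
    exact MonomialOrder.zero_le _ _

/-- The exponent of the leading monomial of the product of the entries of `hsymmMatrix s` in
positions `(j, σ j)`. -/
def permExponent {m n : ℕ} (s : Fin m → Fin n) (σ : Equiv.Perm (Fin m)) : Fin n →₀ ℕ :=
  ∑ j, Finsupp.single (s j) ((s j : ℕ) + 1 - σ j)

theorem permExponent_apply {m n : ℕ} (s : Fin m ↪o Fin n) (σ : Equiv.Perm (Fin m)) (j : Fin m) :
    permExponent s σ (s j) = (s j : ℕ) + 1 - σ j := by
  rw [permExponent, Finsupp.finsetSum_apply, Finset.sum_eq_single j]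
  · simp
  · intro j' _ hj'
    exact Finsupp.single_eq_of_ne fun h => hj' (s.injective h.symm)
  · simp

theorem permExponent_apply_of_notMem {m n : ℕ} (s : Fin m → Fin n) (σ : Equiv.Perm (Fin m))
    {i : Fin n} (hi : i ∉ Set.range s) : permExponent s σ i = 0 := by
  rw [permExponent, Finsupp.finsetSum_apply]
  exact Finset.sum_eq_zero fun j _ => Finsupp.single_eq_of_ne fun h => hi ⟨j, h.symm⟩

theorem val_le_orderEmbedding {m n : ℕ} (s : Fin m ↪o Fin n) (j : Fin m) : (j : ℕ) ≤ s j := by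
  have h1 := countBelow_map s j
  have h2 := countBelow_add_countBelow_compl (Finset.univ.map s.toEmbedding) (s j)
  omega

/-- The first `j` moved by `σ` is moved up, which lowers the exponent of the variable `s j` and
leaves those of all earlier variables unchanged. -/
theorem permExponent_lt {m n : ℕ} (s : Fin m ↪o Fin n) {σ : Equiv.Perm (Fin m)} (hσ : σ ≠ 1) :
    permExponent s σ ≺[MonomialOrder.lex] permExponent s 1 := by
  have hne : (Finset.univ.filter fun j => σ j ≠ j).Nonempty := by
    by_contra h
    rw [Finset.not_nonempty_iff_eq_empty, Finset.filter_eq_empty_iff] at h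
    exact hσ (Equiv.ext fun j => not_not.1 (h (Finset.mem_univ j)))
  have hmem := Finset.min'_mem _ hne
  set j := (Finset.univ.filter fun j => σ j ≠ j).min' hne with hj
  have hmin : ∀ i < j, σ i = i := by
    intro i hi
    by_contra h
    exact (Finset.min'_le _ i (by simpa using h)).not_gt hi
  have hjne : σ j ≠ j := (Finset.mem_filter.1 hmem).2
  have hlt : j < σ j := by
    rcases lt_or_gt_of_ne hjne with h | h
    · exact absurd (σ.injective (hmin _ h)) hjne
    · exact h
  rw [MonomialOrder.lex_lt_iff, Finsupp.Lex.lt_iff]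
  refine ⟨s j, fun i hi => ?_, ?_⟩
  · simp only [ofLex_toLex]
    by_cases h : i ∈ Set.range s
    · obtain ⟨i, rfl⟩ := h
      rw [permExponent_apply, permExponent_apply, hmin i (s.lt_iff_lt.1 hi), Equiv.Perm.one_apply]
    · rw [permExponent_apply_of_notMem s _ h, permExponent_apply_of_notMem s _ h]
  · simp only [ofLex_toLex]
    rw [permExponent_apply, permExponent_apply, Equiv.Perm.one_apply]
    -- Since `j ≤ s j`, the exponent `s j + 1 - j` is positive, so the truncated subtraction does
    -- drop strictly.
    have h1 := val_le_orderEmbedding s j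
    have h2 : (j : ℕ) < σ j := hlt
    omega

theorem degree_prod_hsymmMatrix_le {m n : ℕ} (s : Fin m → Fin n) (σ : Equiv.Perm (Fin m)) :
    MonomialOrder.lex.degree (∏ j, hsymmMatrix s j (σ j))
      ≼[MonomialOrder.lex] permExponent s σ := by
  refine MonomialOrder.degree_prod_le.trans ?_
  rw [permExponent, map_sum, map_sum]
  exact Finset.sum_le_sum fun j _ => degree_hsymmMatrix_le s j (σ j)

theorem coeff_prod_hsymmMatrix_permExponent_one {m n : ℕ} (s : Fin m ↪o Fin n) :
    (∏ j, hsymmMatrix s j j).coeff (permExponent s 1) = 1 := by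
  have hentry : ∀ j, MonomialOrder.lex.degree (hsymmMatrix s j j) =
        Finsupp.single (s j) ((s j : ℕ) + 1 - j) ∧ MonomialOrder.lex.Monic (hsymmMatrix s j j) := by
    intro j
    rw [hsymmMatrix, PowerSeries.coeff_X_pow_mul',
      if_pos ((val_le_orderEmbedding s j).trans (Nat.le_succ _))]
    exact degree_coeff_hsymmSeries _ _
  have hmonic : MonomialOrder.lex.Monic (∏ j, hsymmMatrix s j j) :=
    MonomialOrder.Monic.prod fun j _ => (hentry j).2
  have hdeg : MonomialOrder.lex.degree (∏ j, hsymmMatrix s j j) = permExponent s 1 := by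
    rw [MonomialOrder.degree_prod fun j _ => (hentry j).2.ne_zero, permExponent]
    exact Finset.sum_congr rfl fun j _ => (hentry j).1
  rw [← hdeg]
  exact hmonic.coeff_degree

/-- The diagonal product is monic and strictly dominates every other term of the Leibniz expansion,
so nothing cancels its leading term. -/
theorem degree_det_hsymmMatrix {m n : ℕ} (s : Fin m ↪o Fin n) :
    MonomialOrder.lex.degree (hsymmMatrix s).det = permExponent s 1 ∧
      MonomialOrder.lex.Monic (hsymmMatrix s).det := by
  have hdet : (hsymmMatrix s).det =
      ∑ σ : Equiv.Perm (Fin m), ((Equiv.Perm.sign σ : ℤ) : ℚ) • ∏ j, hsymmMatrix s j (σ j) := by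
    rw [← Matrix.det_transpose, Matrix.det_apply']
    refine Finset.sum_congr rfl fun σ _ => ?_
    rw [Algebra.smul_def]
    simp [Matrix.transpose_apply]
  refine degree_eq_of_coeff_eq_one ?_ ?_
  · rw [hdet]
    refine MonomialOrder.degree_sum_le.trans (Finset.sup_le fun σ _ => ?_)
    refine (MonomialOrder.degree_smul_le.trans (degree_prod_hsymmMatrix_le s σ)).trans ?_
    rcases eq_or_ne σ 1 with rfl | h
    · exact le_rfl
    · exact (permExponent_lt s h).le
  · rw [hdet, coeff_sum, Finset.sum_eq_single 1]
    · rw [coeff_smul]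
      simpa using coeff_prod_hsymmMatrix_permExponent_one s
    · intro σ _ hσ
      rw [coeff_smul, MonomialOrder.coeff_eq_zero_of_lt
        ((degree_prod_hsymmMatrix_le s σ).trans_lt (permExponent_lt s hσ)), smul_zero]
    · simp

theorem leadingMonomial_det_hsymmMatrix {m n : ℕ} (S : Finset (Fin n)) (hS : S.card = m) :
    leadingMonomial MonomialOrder.lex (hsymmMatrix (S.orderEmbOfFin hS)).det = skipMonomial S := by
  rw [leadingMonomial, (degree_det_hsymmMatrix _).1, skipMonomial_eq_monomial, permExponent]
  refine congrArg (fun d => monomial d 1) ?_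
  have : ∑ i ∈ S, Finsupp.single i ((i : ℕ) + 1 - countBelow S i) =
      ∑ i ∈ Finset.univ.map (S.orderEmbOfFin hS).toEmbedding,
        Finsupp.single i ((i : ℕ) + 1 - countBelow S i) := by
    rw [map_orderEmbOfFin_univ]
  rw [this, Finset.sum_map]
  refine Finset.sum_congr rfl fun j _ => ?_
  rw [RelEmbedding.coe_toEmbedding, countBelow_orderEmbOfFin, Equiv.Perm.one_apply]

theorem coeff_esymmSeries_mem {n k r : ℕ} (hr : n - k + 1 ≤ r) :
    PowerSeries.coeff r (esymmSeries n) ∈ idealI n k := by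
  rw [coeff_esymmSeries]
  refine Ideal.mul_mem_left _ _ ?_
  rcases Nat.lt_or_ge n r with h | h
  · rw [esymm, Finset.powersetCard_eq_empty.2 (by simpa using h), Finset.sum_empty]
    exact Ideal.zero_mem _
  · exact Ideal.subset_span (Or.inr ⟨r, ⟨hr, h⟩, rfl⟩)

theorem standardMonomials_subset_nonskipMonomials (n k : ℕ) :
    standardMonomials (MonomialOrder.lex (σ := Fin n)) (idealI n k) ⊆ nonskipMonomials n k := by
  rintro p ⟨hp, hstd⟩
  refine ⟨hp, fun S hS hdvd => ?_, fun i hdvd => ?_⟩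
  · rw [← leadingMonomial_det_hsymmMatrix S hS] at hdvd
    exact hstd _ (det_hsymmMatrix_mem (Nat.succ_pos _) (fun r hr => coeff_esymmSeries_mem hr) _)
      (degree_det_hsymmMatrix _).2.ne_zero hdvd
  · refine hstd (X i ^ k) (Ideal.subset_span (Or.inl ⟨i, rfl⟩)) (pow_ne_zero _ (X_ne_zero i)) ?_
    rwa [leadingMonomial, X_pow_eq_monomial, MonomialOrder.degree_monomial, if_neg one_ne_zero,
      ← X_pow_eq_monomial]

/-! ### Bounding a number of points by a number of spanning monomials -/

/-- The polynomials all of whose monomials have degree less than `d`. -/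
def degreeLTSubmodule (σ : Type*) (d : ℕ) : Submodule ℚ (MvPolynomial σ ℚ) :=
  restrictSupport ℚ {c | c.degree < d}

theorem mem_degreeLTSubmodule {σ : Type*} {d : ℕ} {p : MvPolynomial σ ℚ} :
    p ∈ degreeLTSubmodule σ d ↔ ∀ c, p.coeff c ≠ 0 → c.degree < d := by
  rw [degreeLTSubmodule, mem_restrictSupport_iff]
  exact forall_congr' fun c => by rw [Finset.mem_coe, mem_support_iff]; rfl

theorem mem_degreeLTSubmodule_of_isHomogeneous {σ : Type*} {d e : ℕ} {p : MvPolynomial σ ℚ}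
    (hp : p.IsHomogeneous e) (h : e < d) : p ∈ degreeLTSubmodule σ d := by
  refine mem_degreeLTSubmodule.2 fun c hc => ?_
  by_contra hcd
  exact hc (hp.coeff_eq_zero (by omega))

theorem monomial_mul_mem_degreeLTSubmodule {σ : Type*} {d : ℕ} {p : MvPolynomial σ ℚ}
    (hp : p ∈ degreeLTSubmodule σ d) (u : σ →₀ ℕ) (a : ℚ) :
    monomial u a * p ∈ degreeLTSubmodule σ (u.degree + d) := by
  refine mem_degreeLTSubmodule.2 fun c hc => ?_
  classical
  rw [coeff_monomial_mul'] at hc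
  split_ifs at hc with h
  · have := mem_degreeLTSubmodule.1 hp _ (right_ne_zero_of_mul hc)
    have h2 : c.degree = u.degree + (c - u).degree := by
      rw [← map_add, add_tsub_cancel_of_le h]
    omega
  · exact absurd rfl hc

theorem sub_homogeneousComponent_mem {σ : Type*} {d : ℕ} {p : MvPolynomial σ ℚ}
    (hp : p ∈ degreeLTSubmodule σ (d + 1)) :
    p - homogeneousComponent d p ∈ degreeLTSubmodule σ d := by
  refine mem_degreeLTSubmodule.2 fun c hc => ?_
  rw [coeff_sub, coeff_homogeneousComponent] at hc
  split_ifs at hc with h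
  · exact absurd (sub_self _) hc
  · rw [sub_zero] at hc
    have := mem_degreeLTSubmodule.1 hp c hc
    omega

theorem homogeneousComponent_mem_restrictSupport {σ : Type*} (D : Set (σ →₀ ℕ)) (d : ℕ)
    {p : MvPolynomial σ ℚ} (hp : p ∈ restrictSupport ℚ D) :
    homogeneousComponent d p ∈ restrictSupport ℚ D := by
  rw [mem_restrictSupport_iff] at hp ⊢
  refine fun c hc => hp ?_
  rw [Finset.mem_coe, mem_support_iff, coeff_homogeneousComponent] at hc
  rw [Finset.mem_coe, mem_support_iff]
  split_ifs at hc
  · exact hc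
  · exact absurd rfl hc

/-- As the generators are homogeneous, a component of an ideal element is a sum of monomial
multiples of generators; `ev` cannot tell each of these from something of lower degree. -/
theorem homogeneousComponent_mem_of_span {σ V : Type*} [AddCommGroup V] [Module ℚ V]
    (ev : MvPolynomial σ ℚ →ₗ[ℚ] V)
    (hev : ∀ u a p q, ev p = ev q → ev (monomial u a * p) = ev (monomial u a * q))
    (G : Set (MvPolynomial σ ℚ))
    (hG : ∀ g ∈ G, ∃ d, g.IsHomogeneous d ∧ ∃ h ∈ degreeLTSubmodule σ d, ev g = ev h)
    {g : MvPolynomial σ ℚ} (hg : g ∈ Ideal.span G) (d : ℕ) :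
    ∃ h ∈ degreeLTSubmodule σ d, ev (homogeneousComponent d g) = ev h := by
  have hadd : ∀ {p q : MvPolynomial σ ℚ} (d : ℕ),
      (∃ h ∈ degreeLTSubmodule σ d, ev (homogeneousComponent d p) = ev h) →
      (∃ h ∈ degreeLTSubmodule σ d, ev (homogeneousComponent d q) = ev h) →
      ∃ h ∈ degreeLTSubmodule σ d, ev (homogeneousComponent d (p + q)) = ev h := by
    rintro p q d ⟨h, hh, hp⟩ ⟨h', hh', hq⟩
    exact ⟨h + h', add_mem hh hh', by rw [map_add, map_add, map_add, hp, hq]⟩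
  -- The multiplier `a` is carried along so that the induction over the span survives multiplication
  -- by ring elements.
  suffices H : ∀ (a : MvPolynomial σ ℚ) (d : ℕ),
      ∃ h ∈ degreeLTSubmodule σ d, ev (homogeneousComponent d (a * g)) = ev h by
    simpa using H 1 d
  induction hg using Submodule.span_induction with
  | mem g hg =>
    obtain ⟨e, he, h, hh, hgh⟩ := hG g hg
    intro a
    induction a using MvPolynomial.induction_on' with
    | monomial u a =>
      intro d
      have hhom : (monomial u a * g).IsHomogeneous (u.degree + e) :=
        (isHomogeneous_monomial a rfl).mul he
      rw [homogeneousComponent_of_mem hhom]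
      split_ifs with hd
      · subst hd
        exact ⟨monomial u a * h, monomial_mul_mem_degreeLTSubmodule hh u a, hev u a g h hgh⟩
      · exact ⟨0, zero_mem _, rfl⟩
    | add p q hp hq =>
      intro d
      rw [add_mul]
      exact hadd d (hp d) (hq d)
  | zero => exact fun a d => ⟨0, zero_mem _, by simp⟩
  | add p q _ _ hp hq =>
    intro a d
    rw [mul_add]
    exact hadd d (hp a d) (hq a d)
  | smul b p _ hp =>
    intro a d
    rw [smul_eq_mul, ← mul_assoc]
    exact hp (a * b) d

/-- Induction on degree: the top component of `f` is that of `s` plus that of `f - s` in the ideal,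
and the latter can be traded for lower degree. -/
theorem exists_restrictSupport_of_span {σ V : Type*} [AddCommGroup V] [Module ℚ V]
    (ev : MvPolynomial σ ℚ →ₗ[ℚ] V)
    (hev : ∀ u a p q, ev p = ev q → ev (monomial u a * p) = ev (monomial u a * q))
    (G : Set (MvPolynomial σ ℚ))
    (hG : ∀ g ∈ G, ∃ d, g.IsHomogeneous d ∧ ∃ h ∈ degreeLTSubmodule σ d, ev g = ev h)
    (D : Set (σ →₀ ℕ)) (hD : ∀ f, ∃ s ∈ restrictSupport ℚ D, f - s ∈ Ideal.span G)
    (f : MvPolynomial σ ℚ) : ∃ s ∈ restrictSupport ℚ D, ev f = ev s := by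
  suffices H : ∀ d, ∀ f ∈ degreeLTSubmodule σ d, ∃ s ∈ restrictSupport ℚ D, ev f = ev s by
    refine H (f.totalDegree + 1) f (mem_degreeLTSubmodule.2 fun c hc => ?_)
    exact Nat.lt_succ_of_le (le_totalDegree (mem_support_iff.2 hc))
  intro d
  induction d with
  | zero =>
    intro f hf
    refine ⟨0, zero_mem _, ?_⟩
    have : f = 0 := by
      ext c
      by_contra hc
      exact absurd (mem_degreeLTSubmodule.1 hf c hc) (Nat.not_lt_zero _)
    rw [this]
  | succ d ih =>
    intro f hf
    obtain ⟨s, hs, hfs⟩ := hD f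
    obtain ⟨h, hh, hev'⟩ := homogeneousComponent_mem_of_span ev hev G hG hfs d
    obtain ⟨s', hs', hs''⟩ := ih _ (add_mem hh (sub_homogeneousComponent_mem hf))
    refine ⟨homogeneousComponent d s + s',
      add_mem (homogeneousComponent_mem_restrictSupport D d hs) hs', ?_⟩
    rw [map_add, ← hs'', map_add, ← hev', map_sub, map_sub, map_sub]
    abel

/-- Lagrange interpolation, with products of affine functions separating pairs of points. -/
theorem exists_eval_eq {σ ι : Type*} [Finite ι] (pt : ι → σ → ℚ) (hpt : Function.Injective pt)
    (v : ι → ℚ) : ∃ f : MvPolynomial σ ℚ, ∀ y, eval (pt y) f = v y := by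
  classical
  have := Fintype.ofFinite ι
  have hsep : ∀ y z : ι, ∃ f : MvPolynomial σ ℚ, y ≠ z → eval (pt y) f = 1 ∧ eval (pt z) f = 0 := by
    intro y z
    by_cases h : y = z
    · exact ⟨0, fun h' => absurd h h'⟩
    · obtain ⟨i, hi⟩ := Function.ne_iff.1 (hpt.ne h)
      refine ⟨C (pt y i - pt z i)⁻¹ * (X i - C (pt z i)), fun _ => ⟨?_, ?_⟩⟩
      · simp [inv_mul_cancel₀ (sub_ne_zero.2 hi)]
      · simp
  choose f hf using hsep
  refine ⟨∑ y, C (v y) * ∏ z ∈ Finset.univ.erase y, f y z, fun x => ?_⟩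
  rw [map_sum, Finset.sum_eq_single x]
  · rw [map_mul, eval_C, map_prod, Finset.prod_eq_one, mul_one]
    exact fun z hz => (hf x z (Finset.ne_of_mem_erase hz).symm).1
  · intro y _ hy
    rw [map_mul, map_prod, Finset.prod_eq_zero (Finset.mem_erase.2 ⟨hy.symm, Finset.mem_univ x⟩)
      (hf y x hy).2, mul_zero]
  · simp

/-- A finite set of points on which the leading forms of the generators `G` agree with
polynomials of smaller degree has at most as many points as there are exponents in `D`, if the
monomials with exponent in `D` span modulo `G`. -/
theorem card_points_le {σ ι : Type*} [Finite ι] (pt : ι → σ → ℚ) (hpt : Function.Injective pt)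
    (G : Set (MvPolynomial σ ℚ))
    (hG : ∀ g ∈ G, ∃ d, g.IsHomogeneous d ∧
      ∃ h ∈ degreeLTSubmodule σ d, ∀ y, eval (pt y) g = eval (pt y) h)
    (D : Set (σ →₀ ℕ)) [Finite D]
    (hD : ∀ f, ∃ s ∈ restrictSupport ℚ D, f - s ∈ Ideal.span G) :
    Nat.card ι ≤ Nat.card D := by
  have := Fintype.ofFinite ι
  let ev : MvPolynomial σ ℚ →ₗ[ℚ] ι → ℚ :=
    LinearMap.pi fun y => (aeval (R := ℚ) (pt y)).toLinearMap
  have hev : ∀ p y, ev p y = eval (pt y) p := fun p y => by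
    simp [ev, aeval_eq_eval]
  have hsurj : Function.Surjective (ev.comp (restrictSupport ℚ D).subtype) := by
    intro v
    obtain ⟨f, hf⟩ := exists_eval_eq pt hpt v
    obtain ⟨s, hs, hfs⟩ := exists_restrictSupport_of_span ev
      (fun u a p q h => funext fun y => by
        rw [hev, hev, map_mul, map_mul, ← hev p, ← hev q, h]) G
      (fun g hg => by
        obtain ⟨d, hd, h, hh, hgh⟩ := hG g hg
        exact ⟨d, hd, h, hh, funext fun y => by rw [hev, hev, hgh]⟩) D hD f
    exact ⟨⟨s, hs⟩, funext fun y => by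
      rw [LinearMap.comp_apply, Submodule.subtype_apply, ← hfs, hev, hf]⟩
  have hfin : Module.Finite ℚ (restrictSupport ℚ D) :=
    Module.Finite.of_basis (basisRestrictSupport ℚ D)
  have h1 := LinearMap.finrank_range_le (ev.comp (restrictSupport ℚ D).subtype)
  rwa [LinearMap.range_eq_top.2 hsurj, finrank_top, Module.finrank_fintype_fun_eq_card,
    Module.finrank_eq_nat_card_basis (basisRestrictSupport ℚ D), ← Nat.card_eq_fintype_card] at h1

/-! ### Lowering the degree of the generators on surjective words -/

theorem exists_pow_reduction {n k : ℕ} (i : Fin n) :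
    ∃ h ∈ degreeLTSubmodule (Fin n) k, ∀ w : Fin n → Fin k,
      eval (fun j => ((w j : ℕ) : ℚ)) (X i ^ k) = eval (fun j => ((w j : ℕ) : ℚ)) h := by
  -- Every coordinate of a word is a root of this monic polynomial of degree `k`, so `x_i^k` equals
  -- minus its lower terms there.
  set p : Polynomial ℚ := ∏ j : Fin k, (Polynomial.X - Polynomial.C ((j : ℕ) : ℚ)) with hp
  have hmonic : p.Monic := Polynomial.monic_prod_of_monic _ _ fun j _ => Polynomial.monic_X_sub_C _
  have hdeg : p.natDegree = k := by
    rw [hp, Polynomial.natDegree_prod_of_monic _ _ fun j _ => Polynomial.monic_X_sub_C _]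
    simp only [Polynomial.natDegree_X_sub_C]
    simp
  refine ⟨-∑ l ∈ Finset.range k, C (p.coeff l) * X i ^ l, ?_, fun w => ?_⟩
  · refine neg_mem (sum_mem fun l hl => ?_)
    refine mem_degreeLTSubmodule_of_isHomogeneous (e := 0 + l) ?_
      (by simpa using Finset.mem_range.1 hl)
    exact (isHomogeneous_C _ _).mul (isHomogeneous_X_pow _ _)
  · have h0 : p.eval ((w i : ℕ) : ℚ) = 0 := by
      rw [hp, Polynomial.eval_prod]
      exact Finset.prod_eq_zero (Finset.mem_univ (w i)) (by simp)
    rw [Polynomial.eval_eq_sum_range, hdeg, Finset.sum_range_succ] at h0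
    have hlead : p.coeff k = 1 := by rw [← hdeg]; exact hmonic.coeff_natDegree
    rw [hlead, one_mul] at h0
    simp only [map_pow, map_neg, map_sum, map_mul, eval_X, eval_C]
    linarith

theorem isHomogeneous_esymm (n r : ℕ) : (esymm (Fin n) ℚ r).IsHomogeneous r := by
  refine IsHomogeneous.sum _ _ _ fun t ht => ?_
  have := IsHomogeneous.prod t (fun i => (X i : MvPolynomial (Fin n) ℚ)) (fun _ => 1)
    fun i _ => isHomogeneous_X ℚ i
  rwa [Finset.sum_const, smul_eq_mul, mul_one, (Finset.mem_powersetCard.1 ht).2] at this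

/-- The generating function `∏ 1 / (1 - j T)`, over `j < k`. -/
def gridSeries (k : ℕ) : PowerSeries ℚ :=
  ∏ j : Fin k, PowerSeries.mk fun l => ((j : ℕ) : ℚ) ^ l

/-- Surjectivity provides one position for each letter; these cancel all of `gridSeries k` and leave
`n - k` linear factors. -/
theorem coeff_esymm_eval_mul_gridSeries {n k r : ℕ} (hr : n - k < r) {w : Fin n → Fin k}
    (hw : Function.Surjective w) :
    PowerSeries.coeff r ((∏ i, (1 - PowerSeries.C ((w i : ℕ) : ℚ) * PowerSeries.X)) *
      gridSeries k) = 0 := by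
  classical
  obtain ⟨g, hg⟩ := hw.hasRightInverse
  set s : Finset (Fin n) := Finset.univ.map ⟨g, hg.injective⟩ with hs
  have hcard : sᶜ.card = n - k := by
    rw [Finset.card_compl, hs, Finset.card_map, Finset.card_univ, Fintype.card_fin,
      Fintype.card_fin]
  rw [← Finset.prod_mul_prod_compl s, mul_right_comm, hs, Finset.prod_map, gridSeries,
    ← Finset.prod_mul_distrib, Finset.prod_eq_one, one_mul, ← hs, coeff_prod_one_sub,
    Finset.powersetCard_eq_empty.2 (by omega)]
  · simp
  · intro j _
    rw [Function.Embedding.coeFn_mk, hg j, mul_comm, mk_pow_mul_one_sub]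

theorem constantCoeff_gridSeries (k : ℕ) : PowerSeries.coeff 0 (gridSeries k) = 1 := by
  rw [PowerSeries.coeff_zero_eq_constantCoeff_apply, gridSeries, map_prod]
  refine Finset.prod_eq_one fun j _ => ?_
  rw [← PowerSeries.coeff_zero_eq_constantCoeff_apply, PowerSeries.coeff_mk, pow_zero]

/-- The vanishing coefficient expresses `e_r` through `e_i` with `i < r`, with coefficients
independent of the word. -/
theorem exists_esymm_reduction {n k r : ℕ} (hr : n - k < r) :
    ∃ h ∈ degreeLTSubmodule (Fin n) r, ∀ w : Fin n → Fin k, Function.Surjective w →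
      eval (fun j => ((w j : ℕ) : ℚ)) (esymm (Fin n) ℚ r) =
        eval (fun j => ((w j : ℕ) : ℚ)) h := by
  refine ⟨-((-1) ^ r * ∑ i ∈ Finset.range r, C ((-1) ^ i * PowerSeries.coeff (r - i) (gridSeries k))
    * esymm (Fin n) ℚ i), ?_, fun w hw => ?_⟩
  · have h1 : ((-1) ^ r : MvPolynomial (Fin n) ℚ) = C ((-1) ^ r) := by simp
    rw [h1, ← smul_eq_C_mul]
    refine neg_mem (Submodule.smul_mem _ _ (sum_mem fun i hi => ?_))
    refine mem_degreeLTSubmodule_of_isHomogeneous (e := 0 + i) ?_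
      (by simpa using Finset.mem_range.1 hi)
    exact (isHomogeneous_C _ _).mul (isHomogeneous_esymm n i)
  · have h0 := coeff_esymm_eval_mul_gridSeries hr hw
    have hcoeff : ∀ i, PowerSeries.coeff i
        (∏ i, (1 - PowerSeries.C ((w i : ℕ) : ℚ) * PowerSeries.X)) =
        (-1) ^ i * eval (fun j => ((w j : ℕ) : ℚ)) (esymm (Fin n) ℚ i) := by
      intro i
      rw [coeff_prod_one_sub]
      simp [esymm]
    rw [PowerSeries.coeff_mul, Finset.Nat.sum_antidiagonal_eq_sum_range_succ_mk,
      Finset.sum_range_succ] at h0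
    simp only [hcoeff, Nat.sub_self, constantCoeff_gridSeries, mul_one] at h0
    simp only [map_neg, map_mul, map_pow, map_one, map_sum, eval_C]
    have h2 : ((-1 : ℚ) ^ r) * (-1) ^ r = 1 := by rw [← mul_pow]; simp
    have h3 : ∑ i ∈ Finset.range r, (-1 : ℚ) ^ i * PowerSeries.coeff (r - i) (gridSeries k) *
        eval (fun j => ((w j : ℕ) : ℚ)) (esymm (Fin n) ℚ i) =
        -((-1) ^ r * eval (fun j => ((w j : ℕ) : ℚ)) (esymm (Fin n) ℚ r)) := by
      rw [← eq_neg_of_add_eq_zero_left h0]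
      exact Finset.sum_congr rfl fun i _ => by ring
    rw [h3, mul_neg, neg_neg, ← mul_assoc, h2, one_mul]

/-! ### Standard monomials of an arbitrary ideal -/

/-- The exponents of the standard monomials of an ideal. -/
def standardExponents {σ : Type*} (ord : MonomialOrder σ) (I : Ideal (MvPolynomial σ ℚ)) :
    Set (σ →₀ ℕ) :=
  {a | ∀ f ∈ I, f ≠ 0 → ¬ ord.degree f ≤ a}

theorem standardMonomials_eq_image {σ : Type*} (ord : MonomialOrder σ)
    (I : Ideal (MvPolynomial σ ℚ)) :
    standardMonomials ord I = (fun a => monomial a 1) '' standardExponents ord I := by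
  have key : ∀ a, (∀ f ∈ I, f ≠ 0 → ¬ leadingMonomial ord f ∣ monomial a 1) ↔
      a ∈ standardExponents ord I := fun a => by
    simp only [leadingMonomial, monomial_one_dvd_monomial_one]
    rfl
  ext p
  constructor
  · rintro ⟨⟨a, rfl⟩, h⟩
    exact ⟨a, (key a).1 h, rfl⟩
  · rintro ⟨a, ha, rfl⟩
    exact ⟨⟨a, rfl⟩, (key a).2 ha⟩

theorem exists_standard_remainder {σ : Type*} (ord : MonomialOrder σ)
    (I : Ideal (MvPolynomial σ ℚ)) (f : MvPolynomial σ ℚ) :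
    ∃ s ∈ restrictSupport ℚ (standardExponents ord I), f - s ∈ I := by
  -- Dividing by all nonzero elements of `I` at once makes the remainder standard without a Gröbner
  -- basis.
  obtain ⟨g, r, hf, -, hr⟩ := ord.div_set (B := {b | b ∈ I ∧ b ≠ 0})
    (fun b hb => (ord.leadingCoeff_ne_zero_iff.2 hb.2).isUnit) f
  refine ⟨r, ?_, ?_⟩
  · rw [mem_restrictSupport_iff]
    exact fun c hc b hb hb0 => hr c hc b ⟨hb, hb0⟩
  · rw [hf, add_sub_cancel_right, Finsupp.linearCombination_apply]
    exact I.sum_mem fun b _ => I.mul_mem_left _ b.2.1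

theorem linearIndependent_of_subset_range_monomial {σ : Type*} {A : Set (MvPolynomial σ ℚ)}
    (hA : A ⊆ Set.range fun a => monomial a 1) :
    LinearIndependent ℚ (fun m : A => (m : MvPolynomial σ ℚ)) := by
  have h := (basisMonomials σ ℚ).linearIndependent.linearIndepOn_id
  rw [coe_basisMonomials] at h
  exact h.mono hA

/-- The cosets of the standard monomials form a basis of the quotient. -/
theorem exists_basis_standardMonomials {σ : Type*} (ord : MonomialOrder σ)
    (I : Ideal (MvPolynomial σ ℚ)) :
    ∃ b : Module.Basis (standardMonomials ord I) ℚ (MvPolynomial σ ℚ ⧸ I),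
      ∀ m : standardMonomials ord I, b m = Ideal.Quotient.mk I (m : MvPolynomial σ ℚ) := by
  let q : MvPolynomial σ ℚ →ₗ[ℚ] MvPolynomial σ ℚ ⧸ I := (Ideal.Quotient.mkₐ ℚ I).toLinearMap
  have hspan : Submodule.span ℚ (Set.range fun m : standardMonomials ord I =>
      (m : MvPolynomial σ ℚ)) = restrictSupport ℚ (standardExponents ord I) := by
    rw [Subtype.range_coe, restrictSupport_eq_span, standardMonomials_eq_image]
  have hli : LinearIndependent ℚ
      (q ∘ fun m : standardMonomials ord I => (m : MvPolynomial σ ℚ)) := by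
    refine (linearIndependent_of_subset_range_monomial ?_).map ?_
    · rw [standardMonomials_eq_image]
      exact Set.image_subset_range _ _
    · rw [hspan, Submodule.disjoint_def]
      intro f hf hker
      by_contra hf0
      have hfI : f ∈ I := Ideal.Quotient.eq_zero_iff_mem.1 (LinearMap.mem_ker.1 hker)
      -- The leading exponent of `f` would be standard, yet it is divisible by itself.
      exact (mem_restrictSupport_iff ℚ).1 hf (ord.degree_mem_support hf0) f hfI hf0 le_rfl
  refine ⟨Module.Basis.mk hli ?_, fun m => by rw [Module.Basis.mk_apply]; rfl⟩
  rintro x -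
  obtain ⟨f, rfl⟩ := Ideal.Quotient.mk_surjective x
  obtain ⟨s, hs, hfs⟩ := exists_standard_remainder ord I f
  rw [Set.range_comp, ← Submodule.map_span, hspan]
  exact ⟨s, hs, (Ideal.Quotient.eq.2 hfs).symm⟩

/-! ### Comparing the two counts -/

theorem card_surjective_le_card_standardExponents (n k : ℕ) (ord : MonomialOrder (Fin n))
    [Finite (standardExponents ord (idealI n k))] :
    Nat.card {w : Fin n → Fin k // Function.Surjective w} ≤
      Nat.card (standardExponents ord (idealI n k)) := by
  refine card_points_le (fun w j => ((w.1 j : ℕ) : ℚ)) ?_ _ ?_ _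
    (exists_standard_remainder ord (idealI n k))
  · intro w w' h
    refine Subtype.ext (funext fun j => Fin.ext ?_)
    exact Nat.cast_injective (congrFun h j)
  · rintro g (⟨i, rfl⟩ | ⟨r, hr, rfl⟩)
    · obtain ⟨h, hh, hw⟩ := exists_pow_reduction (k := k) i
      exact ⟨k, isHomogeneous_X_pow i k, h, hh, fun w => hw w.1⟩
    · obtain ⟨h, hh, hw⟩ := exists_esymm_reduction (n := n) (k := k) (r := r) hr.1
      exact ⟨r, isHomogeneous_esymm n r, h, hh, fun w => hw w.1 w.2⟩

/-- An inclusion into a finite set whose size is at most the number of surjections, itself at most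
the size of the subset. -/
theorem standardExponents_eq {n k : ℕ} (hkn : k ≤ n) :
    standardExponents (MonomialOrder.lex (σ := Fin n)) (idealI n k) =
      {a : Fin n →₀ ℕ | IsArtin n k a} := by
  have hsub : standardExponents (MonomialOrder.lex (σ := Fin n)) (idealI n k) ⊆
      {a : Fin n →₀ ℕ | IsArtin n k a} := by
    intro a ha
    have h : monomial a 1 ∈ standardMonomials (MonomialOrder.lex (σ := Fin n)) (idealI n k) := by
      rw [standardMonomials_eq_image]
      exact ⟨a, ha, rfl⟩
    exact (isArtin_iff_isNonskip hkn a).2 ((monomial_mem_nonskipMonomials_iff a).1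
      (standardMonomials_subset_nonskipMonomials n k h))
  obtain ⟨hfin, hcard⟩ := card_isArtin_le hkn
  have hfin' : {a : Fin n →₀ ℕ | IsArtin n k a}.Finite := hfin
  have := (hfin'.subset hsub).to_subtype
  refine Set.eq_of_subset_of_ncard_le hsub ?_ hfin'
  exact hcard.trans (card_surjective_le_card_standardExponents n k _)

end DeltaArtin

end

/-- Here `MonomialOrder.lex` compares the exponent of the first variable first, so that
`x_1 > x_2 > ⋯ > x_n`. -/
theorem mainTheorem4 (n k : ℕ) (hk : 0 < k) (hkn : k ≤ n) :
    DeltaArtin.artinMonomials n k = DeltaArtin.nonskipMonomials n k ∧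
    DeltaArtin.artinMonomials n k =
      DeltaArtin.standardMonomials (MonomialOrder.lex (σ := Fin n)) (DeltaArtin.idealI n k) ∧
    ∃ b : Module.Basis (DeltaArtin.artinMonomials n k) ℚ (DeltaArtin.RingR n k),
      ∀ m : DeltaArtin.artinMonomials n k,
        b m = Ideal.Quotient.mk (DeltaArtin.idealI n k) (m : MvPolynomial (Fin n) ℚ) := by
  have hstd : DeltaArtin.artinMonomials n k =
      DeltaArtin.standardMonomials (MonomialOrder.lex (σ := Fin n)) (DeltaArtin.idealI n k) := by
    rw [DeltaArtin.artinMonomials_eq_image hk, DeltaArtin.standardMonomials_eq_image,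
      DeltaArtin.standardExponents_eq hkn]
  refine ⟨DeltaArtin.artinMonomials_eq_nonskipMonomials hk hkn, hstd, ?_⟩
  rw [hstd]
  exact DeltaArtin.exists_basis_standardMonomials _ _
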